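/- Let $m\ge 3$ and $n\ge 3$ be integers. Then there is a set of $2(m+n)-4$ pairwise orthogonal product states in $\mathbb{C}^m\otimes\mathbb{C}^n$ that cannot be perfectly distinguished by local operations and classical communication (LOCC). Explicitly (states are not normalized), let $\omega=e^{2\pi\sqrt{-1}/3}$ and let $|0\rangle,\dots,|d-1\rangle$ be the standard basis of $\mathbb{C}^d$. For $s\in\{0,1\}$ and $d\ge 3$ let $E_d^{s}\subset\mathbb{C}^d$ be the set of the following $d-1$ vectors: if $d$ is odd, the vectors $|s+2\delta\rangle\pm|s+2\delta+1\rangle$ with $0\le\delta<(d-1)/2$; if $d$ is even, the three vectors $\sum_{j=0}^{2}\omega^{tj}|s+j\rangle$ with $t=0,1,2$, together with the vectors $|s+3+2\delta\rangle\pm|s+4+2\delta\rangle$ with $0\le\delta<d/2-2$. Let $$S_{m,n}=\{|0\rangle\otimes v: v\in E_n^0\}\cup\{u\otimes|n-1\rangle: u\in E_m^0\}\cup\{|m-1\rangle\otimes v: v\in E_n^1\}\cup\{u\otimes|0\rangle: u\in E_m^1\}.$$ Then: 1. $S_{m,n}$ has exactly $2(m+n)-4$ elements, and these are pairwise orthogonal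 product states. 2. $S_{m,n}$ cannot be perfectly distinguished by LOCC: there is no protocol in which the two parties, in any order, perform local measurements $\{M_k\}_{k=1}^{l}$ with $\sum_k M_k^\dagger M_k=I$, each of which may depend on all earlier, publicly announced outcomes, with any number of rounds, and which for every state of $S_{m,n}$ halts with probability $1$ with the correct identification of that state. 3. Adding to $S_{m,n}$ the states $|i\rangle\otimes|j\rangle$ with $1\le i\le m-2$, $1\le j\le n-2$ gives a complete orthogonal product basis of $\mathbb{C}^m\otimes\mathbb{C}^n$. -/

import Mathlib

open scoped TensorProduct InnerProductSpace

noncomputable section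

/-- The state space `ℂ^d` with its standard inner product. -/
abbrev Qudit (d : ℕ) : Type := EuclideanSpace ℂ (Fin d)

/-- The bipartite state space `ℂ^a ⊗ ℂ^b` with the tensor product inner product. -/
abbrev Bipartite (a b : ℕ) : Type := Qudit a ⊗[ℂ] Qudit b

/-- The computational basis vector `|i⟩` of `ℂ^d`, for `i = 0, …, d - 1`
(zero for larger `i`). -/
def ket (d i : ℕ) : Qudit d := WithLp.toLp 2 fun k => if (k : ℕ) = i then 1 else 0

/-! ### Orthogonal product states -/

/-- A (not necessarily normalized, but non-zero) product state. -/
def IsProductState {m n : ℕ} (ψ : Bipartite m n) : Prop :=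
  ψ ≠ 0 ∧ ∃ (u : Qudit m) (v : Qudit n), ψ = u ⊗ₜ[ℂ] v

/-- A set of pairwise orthogonal product states. -/
def IsOrthogonalProductSet {m n : ℕ} (S : Set (Bipartite m n)) : Prop :=
  (∀ ψ ∈ S, IsProductState ψ) ∧ ∀ ψ ∈ S, ∀ φ ∈ S, ψ ≠ φ → ⟪ψ, φ⟫_ℂ = 0

/-- A complete orthogonal product basis of `ℂ^m ⊗ ℂ^n`. -/
def IsOrthogonalProductBasis {m n : ℕ} (S : Set (Bipartite m n)) : Prop :=
  IsOrthogonalProductSet S ∧ Submodule.span ℂ S = ⊤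

/-! ### Local operations and classical communication -/

/-- What the parties do in one round, when their local systems have dimensions `a` and `b` and
`Conf a' b'` is the type of the configurations (classical records shared by both parties) with
local dimensions `a'` and `b'`: they halt and announce a guess, or one of them makes a
measurement with finitely many outcomes `k`, given by operators `M k` on the local system with
`∑ k, M k† M k = I`, and announces the outcome. The dimension of the measured system may change
(local ancillas may be added or discarded). -/
inductive LOCCStep (Conf : ℕ → ℕ → Type) (ι : Type) (a b : ℕ) : Type
  | halt (guess : ι)
  | alice (l : ℕ) (d : Fin l → ℕ) (M : (k : Fin l) → Qudit a →ₗ[ℂ] Qudit (d k))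
      (complete : ∑ k, LinearMap.adjoint (M k) ∘ₗ M k = LinearMap.id)
      (next : (k : Fin l) → Conf (d k) b)
  | bob (l : ℕ) (d : Fin l → ℕ) (M : (k : Fin l) → Qudit b →ₗ[ℂ] Qudit (d k))
      (complete : ∑ k, LinearMap.adjoint (M k) ∘ₗ M k = LinearMap.id)
      (next : (k : Fin l) → Conf a (d k))

/-- An LOCC protocol on `ℂ^m ⊗ ℂ^n` whose aim is to guess an element of `ι`. Every step may
depend on all that was announced before, and the number of rounds is not bounded. -/
structure LOCCProtocol (ι : Type) (m n : ℕ) where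
  /-- The configurations, sorted by the current dimensions of the two local systems. -/
  Conf : ℕ → ℕ → Type
  /-- The step that is taken in a configuration. -/
  step : (a b : ℕ) → Conf a b → LOCCStep Conf ι a b
  /-- The configuration in which the protocol starts. -/
  start : Conf m n

open Classical in
/-- The squared norm of the part of `ψ` on which the protocol, run from the configuration `c`,
halts after at most `N` measurements with the guess `i`. For a unit vector `ψ` this is the
probability of that event. -/
def LOCCProtocol.weight {ι : Type} {m n : ℕ} (P : LOCCProtocol ι m n) (i : ι) :
    ℕ → (a b : ℕ) → P.Conf a b → Bipartite a b → ℝ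
  | 0, a, b, c, ψ =>
    match P.step a b c with
    | .halt g => if g = i then ‖ψ‖ ^ 2 else 0
    | .alice _ _ _ _ _ => 0
    | .bob _ _ _ _ _ => 0
  | N + 1, a, b, c, ψ =>
    match P.step a b c with
    | .halt g => if g = i then ‖ψ‖ ^ 2 else 0
    | .alice _ d M _ next =>
        ∑ k, P.weight i N (d k) b (next k) (TensorProduct.map (M k) LinearMap.id ψ)
    | .bob _ d M _ next =>
        ∑ k, P.weight i N a (d k) (next k) (TensorProduct.map LinearMap.id (M k) ψ)

/-- The probability that the protocol, applied to the (normalized) state `ψ`, halts after at most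
`N` measurements with the guess `i`. -/
def LOCCProtocol.prob {ι : Type} {m n : ℕ} (P : LOCCProtocol ι m n) (i : ι) (N : ℕ)
    (ψ : Bipartite m n) : ℝ :=
  P.weight i N m n P.start ψ / ‖ψ‖ ^ 2

/-- The states in `S` can be perfectly distinguished by LOCC: some protocol halts, with
probability one, with the correct guess, whichever state of `S` is given. -/
def LOCCDistinguishable {m n : ℕ} (S : Set (Bipartite m n)) : Prop :=
  ∃ P : LOCCProtocol (Bipartite m n) m n, ∀ ψ ∈ S,
    Filter.Tendsto (fun N => P.prob ψ N ψ) Filter.atTop (nhds 1)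

/-! ### The states -/

/-- The two vectors `|i⟩ ± |i+1⟩` of `ℂ^d`. -/
def pairVectors (d i : ℕ) : Set (Qudit d) :=
  {ket d i + ket d (i + 1), ket d i - ket d (i + 1)}

/-- The three vectors `∑_{j=0}^{2} ω^{tj} |i+j⟩` of `ℂ^d`, where `t = 0, 1, 2` and
`ω = exp (2πi/3)`. -/
def tripleVectors (d i : ℕ) : Set (Qudit d) :=
  {v | ∃ t < 3, v = ∑ j ∈ Finset.range 3,
    Complex.exp (2 * Real.pi * Complex.I / 3) ^ (t * j) • ket d (i + j)}

/-- `d - 1` orthogonal vectors of `ℂ^d` that span the same space as `|s⟩, …, |s+d-2⟩` (here `s = 0` or `s = 1`):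
the pairs that start at `s, s + 2, s + 4, …` if `d` is odd, and the triple that starts at `s`
together with the pairs that start at `s + 3, s + 5, …` if `d` is even. -/
def edgeVectors (d s : ℕ) : Set (Qudit d) :=
  if Odd d then {v | ∃ δ < (d - 1) / 2, v ∈ pairVectors d (s + 2 * δ)}
  else tripleVectors d s ∪ {v | ∃ δ < d / 2 - 2, v ∈ pairVectors d (s + 3 + 2 * δ)}

/-- The set of orthogonal product states, arranged in four families around the boundary of the
`m × n` grid of the states `|i⟩|j⟩`. -/
def boundarySet (m n : ℕ) : Set (Bipartite m n) :=
  {ψ | ∃ v ∈ edgeVectors n 0, ψ = ket m 0 ⊗ₜ[ℂ] v} ∪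
  {ψ | ∃ u ∈ edgeVectors m 0, ψ = u ⊗ₜ[ℂ] ket n (n - 1)} ∪
  {ψ | ∃ v ∈ edgeVectors n 1, ψ = ket m (m - 1) ⊗ₜ[ℂ] v} ∪
  {ψ | ∃ u ∈ edgeVectors m 1, ψ = u ⊗ₜ[ℂ] ket n 0}

/-- The states `|i⟩|j⟩` with `1 ≤ i ≤ m - 2` and `1 ≤ j ≤ n - 2`. -/
def interiorSet (m n : ℕ) : Set (Bipartite m n) :=
  {ψ | ∃ i j : ℕ, 1 ≤ i ∧ i ≤ m - 2 ∧ 1 ≤ j ∧ j ≤ n - 2 ∧ ψ = ket m i ⊗ₜ[ℂ] ket n j}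

end

/-! The argument shows that no useful measurement can ever start. As long as the local operators
`A`, `B` accumulated so far satisfy `A†A = x I` and `B†B = y I`, overlaps of states are only
multiplied by `xy`. If the protocol succeeds surely, the images of distinct states of `S` must stay
orthogonal after every outcome (`GuessesSurely.inner_eq_zero`). For the next measurement operator
this says that the new `E = A†A` (or its counterpart for `B`) preserves orthogonality of `S`. If
every such Hermitian `E` is scalar, the hypothesis propagates through all rounds. A branch that
halts then needs `xy = 0`, since one guess cannot serve two states, so every finite-round success
weight vanishes and cannot tend to a positive norm (`not_LOCCDistinguishable_of_trivial`).

For the boundary set, such an `E` has every edge vector as an eigenvector: each family of edge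
vectors is an orthogonal basis once one end ket is added. The blocks of the two families are shifted
by one and overlap, so all neighbouring kets lie in a common block. Overlapping eigenvectors of a
Hermitian map share their eigenvalue, and the eigenvalue of `ket d 0` spreads along the chain to all
kets (`exists_eq_smul_id_of_edgeVectors`).

The four edges, each without one of its corners, tile the boundary of the grid cyclically. This
gives orthogonality and completeness, and the cardinality follows by subtracting the interior from
`m * n`. -/

namespace LOCCProtocol

/-! ### Unfolding the success weight along one step. -/

variable {ι : Type} {m n : ℕ} (P : LOCCProtocol ι m n) {a b : ℕ}

open Classical in
theorem weight_of_halt {c : P.Conf a b} {g : ι} (h : P.step a b c = .halt g) (i : ι) (N : ℕ)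
    (ψ : Bipartite a b) : P.weight i N a b c ψ = if g = i then ‖ψ‖ ^ 2 else 0 := by
  cases N <;> rw [weight, h]

theorem weight_zero_of_alice {c : P.Conf a b} {l d M hM next}
    (h : P.step a b c = .alice l d M hM next) (i : ι) (ψ : Bipartite a b) :
    P.weight i 0 a b c ψ = 0 := by
  rw [weight, h]

theorem weight_zero_of_bob {c : P.Conf a b} {l d M hM next}
    (h : P.step a b c = .bob l d M hM next) (i : ι) (ψ : Bipartite a b) :
    P.weight i 0 a b c ψ = 0 := by
  rw [weight, h]

theorem weight_succ_of_alice {c : P.Conf a b} {l d M hM next}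
    (h : P.step a b c = .alice l d M hM next) (i : ι) (N : ℕ) (ψ : Bipartite a b) :
    P.weight i (N + 1) a b c ψ =
      ∑ k, P.weight i N (d k) b (next k) (TensorProduct.map (M k) LinearMap.id ψ) := by
  rw [weight, h]

theorem weight_succ_of_bob {c : P.Conf a b} {l d M hM next}
    (h : P.step a b c = .bob l d M hM next) (i : ι) (N : ℕ) (ψ : Bipartite a b) :
    P.weight i (N + 1) a b c ψ =
      ∑ k, P.weight i N a (d k) (next k) (TensorProduct.map LinearMap.id (M k) ψ) := by
  rw [weight, h]

end LOCCProtocol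

/-! ### Conservation of inner products under a complete measurement. -/

theorem sum_inner_apply {E : Type*} [NormedAddCommGroup E] [InnerProductSpace ℂ E] {l : ℕ}
    (T : Fin l → E →ₗ[ℂ] E) (x y : E) : ∑ k, ⟪x, T k y⟫_ℂ = ⟪x, (∑ k, T k) y⟫_ℂ := by
  rw [LinearMap.sum_apply, inner_sum]

/-- Each `M k` moves across the inner product as its adjoint, so only the completeness relation
enters. Taking `ψ = φ` conserves total probability; `ψ ≠ φ` is needed to control overlaps. -/
theorem sum_inner_map_left {a b l : ℕ} {d : Fin l → ℕ}
    {M : (k : Fin l) → Qudit a →ₗ[ℂ] Qudit (d k)}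
    (hM : ∑ k, LinearMap.adjoint (M k) ∘ₗ M k = LinearMap.id) (ψ φ : Bipartite a b) :
    ∑ k, ⟪TensorProduct.map (M k) LinearMap.id ψ, TensorProduct.map (M k) LinearMap.id φ⟫_ℂ
      = ⟪ψ, φ⟫_ℂ := by
  have h (k) : ⟪TensorProduct.map (M k) LinearMap.id ψ, TensorProduct.map (M k) LinearMap.id φ⟫_ℂ
      = ⟪ψ, LinearMap.rTensor (Qudit b) (LinearMap.adjoint (M k) ∘ₗ M k) φ⟫_ℂ := by
    rw [← LinearMap.adjoint_inner_right, TensorProduct.adjoint_map, ← LinearMap.comp_apply,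
      ← TensorProduct.map_comp]
    simp [LinearMap.rTensor]
  simp_rw [h]
  rw [sum_inner_apply]
  simp_rw [← LinearMap.coe_rTensorHom]
  rw [← map_sum, hM]
  simp

theorem sum_inner_map_right {a b l : ℕ} {d : Fin l → ℕ}
    {M : (k : Fin l) → Qudit b →ₗ[ℂ] Qudit (d k)}
    (hM : ∑ k, LinearMap.adjoint (M k) ∘ₗ M k = LinearMap.id) (ψ φ : Bipartite a b) :
    ∑ k, ⟪TensorProduct.map LinearMap.id (M k) ψ, TensorProduct.map LinearMap.id (M k) φ⟫_ℂ
      = ⟪ψ, φ⟫_ℂ := by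
  have h (k) : ⟪TensorProduct.map LinearMap.id (M k) ψ, TensorProduct.map LinearMap.id (M k) φ⟫_ℂ
      = ⟪ψ, LinearMap.lTensor (Qudit a) (LinearMap.adjoint (M k) ∘ₗ M k) φ⟫_ℂ := by
    rw [← LinearMap.adjoint_inner_right, TensorProduct.adjoint_map, ← LinearMap.comp_apply,
      ← TensorProduct.map_comp]
    simp [LinearMap.lTensor]
  simp_rw [h]
  rw [sum_inner_apply]
  simp_rw [← LinearMap.coe_lTensorHom]
  rw [← map_sum, hM]
  simp

theorem sum_norm_sq_of_sum_inner {E : Type*} [NormedAddCommGroup E] [InnerProductSpace ℂ E] {l : ℕ}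
    {F : Fin l → Type*} [∀ k, NormedAddCommGroup (F k)] [∀ k, InnerProductSpace ℂ (F k)]
    {x : E} {y : (k : Fin l) → F k} (h : ∑ k, ⟪y k, y k⟫_ℂ = ⟪x, x⟫_ℂ) :
    ∑ k, ‖y k‖ ^ 2 = ‖x‖ ^ 2 := by
  simp_rw [inner_self_eq_norm_sq_to_K] at h
  exact_mod_cast h

theorem sum_norm_sq_map_left {a b l : ℕ} {d : Fin l → ℕ}
    {M : (k : Fin l) → Qudit a →ₗ[ℂ] Qudit (d k)}
    (hM : ∑ k, LinearMap.adjoint (M k) ∘ₗ M k = LinearMap.id) (ψ : Bipartite a b) :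
    ∑ k, ‖TensorProduct.map (M k) LinearMap.id ψ‖ ^ 2 = ‖ψ‖ ^ 2 :=
  sum_norm_sq_of_sum_inner (y := fun k => TensorProduct.map (M k) LinearMap.id ψ)
    (sum_inner_map_left hM ψ ψ)

theorem sum_norm_sq_map_right {a b l : ℕ} {d : Fin l → ℕ}
    {M : (k : Fin l) → Qudit b →ₗ[ℂ] Qudit (d k)}
    (hM : ∑ k, LinearMap.adjoint (M k) ∘ₗ M k = LinearMap.id) (ψ : Bipartite a b) :
    ∑ k, ‖TensorProduct.map LinearMap.id (M k) ψ‖ ^ 2 = ‖ψ‖ ^ 2 :=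
  sum_norm_sq_of_sum_inner (y := fun k => TensorProduct.map LinearMap.id (M k) ψ)
    (sum_inner_map_right hM ψ ψ)

/-! ### Bounds on weights, and sure guessing along branches. -/

namespace LOCCProtocol

variable {ι : Type} {m n : ℕ} (P : LOCCProtocol ι m n)

theorem weight_nonneg (i : ι) (N : ℕ) {a b : ℕ} (c : P.Conf a b) (ψ : Bipartite a b) :
    0 ≤ P.weight i N a b c ψ := by
  induction N generalizing a b with
  | zero =>
    cases h : P.step a b c with
    | halt g => rw [P.weight_of_halt h]; split_ifs <;> positivity
    | alice => rw [P.weight_zero_of_alice h]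
    | bob => rw [P.weight_zero_of_bob h]
  | succ N ih =>
    cases h : P.step a b c with
    | halt g => rw [P.weight_of_halt h]; split_ifs <;> positivity
    | alice => rw [P.weight_succ_of_alice h]; exact Finset.sum_nonneg fun k _ => ih _ _
    | bob => rw [P.weight_succ_of_bob h]; exact Finset.sum_nonneg fun k _ => ih _ _

theorem weight_le (i : ι) (N : ℕ) {a b : ℕ} (c : P.Conf a b) (ψ : Bipartite a b) :
    P.weight i N a b c ψ ≤ ‖ψ‖ ^ 2 := by
  induction N generalizing a b with
  | zero =>
    cases h : P.step a b c with
    | halt g => rw [P.weight_of_halt h]; split_ifs; exacts [le_rfl, by positivity]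
    | alice => rw [P.weight_zero_of_alice h]; positivity
    | bob => rw [P.weight_zero_of_bob h]; positivity
  | succ N ih =>
    cases h : P.step a b c with
    | halt g => rw [P.weight_of_halt h]; split_ifs; exacts [le_rfl, by positivity]
    | alice l d M hM next =>
      rw [P.weight_succ_of_alice h, ← sum_norm_sq_map_left hM ψ]
      exact Finset.sum_le_sum fun k _ => ih _ _
    | bob l d M hM next =>
      rw [P.weight_succ_of_bob h, ← sum_norm_sq_map_right hM ψ]
      exact Finset.sum_le_sum fun k _ => ih _ _

/-- Run from the configuration `c` on the state `ψ`, the protocol almost surely halts with the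
guess `i`. -/
def GuessesSurely {a b : ℕ} (c : P.Conf a b) (i : ι) (ψ : Bipartite a b) : Prop :=
  Filter.Tendsto (fun N => P.weight i N a b c ψ) Filter.atTop (nhds (‖ψ‖ ^ 2))

end LOCCProtocol

/-- All deficits `r k - f k N` are nonnegative, so each is squeezed between zero and the total
deficit, which tends to zero. -/
theorem tendsto_of_tendsto_sum {κ : Type*} [Fintype κ] {f : κ → ℕ → ℝ} {r : κ → ℝ}
    (hf : ∀ k N, f k N ≤ r k)
    (h : Filter.Tendsto (fun N => ∑ k, f k N) Filter.atTop (nhds (∑ k, r k))) (k : κ) :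
    Filter.Tendsto (f k) Filter.atTop (nhds (r k)) := by
  have h0 : Filter.Tendsto (fun N => r k - (∑ k, r k - ∑ k, f k N)) Filter.atTop (nhds (r k)) := by
    simpa using (h.const_sub (∑ k, r k)).const_sub (r k)
  refine tendsto_of_tendsto_of_tendsto_of_le_of_le h0 tendsto_const_nhds (fun N => ?_) (hf k)
  have := Finset.single_le_sum (f := fun k => r k - f k N) (s := Finset.univ)
    (fun k _ => sub_nonneg.2 (hf k N)) (Finset.mem_univ k)
  rw [Finset.sum_sub_distrib] at this
  dsimp only at this ⊢
  linarith

namespace LOCCProtocol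

variable {ι : Type} {m n : ℕ} {P : LOCCProtocol ι m n} {a b : ℕ}

theorem GuessesSurely.of_halt {c : P.Conf a b} {g i : ι} {ψ : Bipartite a b}
    (hc : P.GuessesSurely c i ψ) (h : P.step a b c = .halt g) : g = i ∨ ψ = 0 := by
  by_cases hg : g = i
  · exact .inl hg
  · right
    simp only [GuessesSurely, P.weight_of_halt h, if_neg hg] at hc
    simpa using (tendsto_nhds_unique hc tendsto_const_nhds)

theorem GuessesSurely.of_alice {c : P.Conf a b} {i : ι} {ψ : Bipartite a b} {l d M hM next}
    (hc : P.GuessesSurely c i ψ) (h : P.step a b c = .alice l d M hM next) (k : Fin l) :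
    P.GuessesSurely (next k) i (TensorProduct.map (M k) LinearMap.id ψ) := by
  refine tendsto_of_tendsto_sum
    (f := fun k N => P.weight i N _ _ (next k) (TensorProduct.map (M k) LinearMap.id ψ))
    (fun k N => P.weight_le i N (next k) _) ?_ k
  rw [sum_norm_sq_map_left hM ψ]
  -- The limit is unaffected by the shift of `N` that accounts for the measurement itself.
  simpa only [P.weight_succ_of_alice h] using (Filter.tendsto_add_atTop_iff_nat 1).2 hc

theorem GuessesSurely.of_bob {c : P.Conf a b} {i : ι} {ψ : Bipartite a b} {l d M hM next}
    (hc : P.GuessesSurely c i ψ) (h : P.step a b c = .bob l d M hM next) (k : Fin l) :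
    P.GuessesSurely (next k) i (TensorProduct.map LinearMap.id (M k) ψ) := by
  refine tendsto_of_tendsto_sum
    (f := fun k N => P.weight i N _ _ (next k) (TensorProduct.map LinearMap.id (M k) ψ))
    (fun k N => P.weight_le i N (next k) _) ?_ k
  rw [sum_norm_sq_map_right hM ψ]
  simpa only [P.weight_succ_of_bob h] using (Filter.tendsto_add_atTop_iff_nat 1).2 hc

end LOCCProtocol

/-! ### Orthogonality of states that are guessed apart. -/

/-- The overlap and both residual norms add up over outcomes; the triangle inequality followed by
Cauchy–Schwarz over `k` assembles the branch bounds. -/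
theorem norm_inner_le_of_sum {E : Type*} [NormedAddCommGroup E] [InnerProductSpace ℂ E] {l : ℕ}
    {F : Fin l → Type*} [∀ k, NormedAddCommGroup (F k)] [∀ k, InnerProductSpace ℂ (F k)]
    {x x' : E} {y y' : (k : Fin l) → F k} {p q : Fin l → ℝ}
    (h : ∑ k, ⟪y k, y k⟫_ℂ = ⟪x, x⟫_ℂ) (h' : ∑ k, ⟪y' k, y' k⟫_ℂ = ⟪x', x'⟫_ℂ)
    (hxx : ∑ k, ⟪y k, y' k⟫_ℂ = ⟪x, x'⟫_ℂ) (hp : ∀ k, p k ≤ ‖y k‖ ^ 2) (hq : ∀ k, q k ≤ ‖y' k‖ ^ 2)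
    (hle : ∀ k, ‖⟪y k, y' k⟫_ℂ‖ ≤ √(‖y k‖ ^ 2 - p k) * √(‖y' k‖ ^ 2 - q k)) :
    ‖⟪x, x'⟫_ℂ‖ ≤ √(‖x‖ ^ 2 - ∑ k, p k) * √(‖x'‖ ^ 2 - ∑ k, q k) := by
  rw [← hxx, ← sum_norm_sq_of_sum_inner h, ← sum_norm_sq_of_sum_inner h',
    ← Finset.sum_sub_distrib, ← Finset.sum_sub_distrib]
  refine (norm_sum_le _ _).trans ((Finset.sum_le_sum fun k _ => hle k).trans ?_)
  exact Real.sum_sqrt_mul_sqrt_le _ (fun k => sub_nonneg.2 (hp k)) (fun k => sub_nonneg.2 (hq k))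

namespace LOCCProtocol

variable {ι : Type} {m n : ℕ} {P : LOCCProtocol ι m n}

/-- Only the parts not yet correctly guessed after `N` measurements can contribute to the overlap.
Before any halt the bound is plain Cauchy–Schwarz; at a halt a single guess forces one of the two
states to be zero. Since `N` is arbitrary, protocols with unboundedly many rounds are covered. -/
theorem GuessesSurely.norm_inner_le {i j : ι} (hij : i ≠ j) (N : ℕ) {a b : ℕ} {c : P.Conf a b}
    {ψ φ : Bipartite a b} (hψ : P.GuessesSurely c i ψ) (hφ : P.GuessesSurely c j φ) :
    ‖⟪ψ, φ⟫_ℂ‖ ≤ √(‖ψ‖ ^ 2 - P.weight i N a b c ψ) * √(‖φ‖ ^ 2 - P.weight j N a b c φ) := by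
  have halt (N : ℕ) {a b : ℕ} {c : P.Conf a b} {ψ φ : Bipartite a b} (hψ : P.GuessesSurely c i ψ)
      (hφ : P.GuessesSurely c j φ) {g : ι} (h : P.step a b c = .halt g) :
      ‖⟪ψ, φ⟫_ℂ‖ ≤
        √(‖ψ‖ ^ 2 - P.weight i N a b c ψ) * √(‖φ‖ ^ 2 - P.weight j N a b c φ) := by
    have : ⟪ψ, φ⟫_ℂ = 0 := by
      rcases hψ.of_halt h with rfl | rfl
      · rcases hφ.of_halt h with h | rfl
        exacts [(hij h).elim, inner_zero_right _]
      · exact inner_zero_left _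
    rw [this, norm_zero]
    positivity
  induction N generalizing a b with
  | zero =>
    cases h : P.step a b c with
    | halt g => exact halt 0 hψ hφ h
    | alice => simpa [P.weight_zero_of_alice h] using norm_inner_le_norm ψ φ
    | bob => simpa [P.weight_zero_of_bob h] using norm_inner_le_norm ψ φ
  | succ N ih =>
    cases h : P.step a b c with
    | halt g => exact halt _ hψ hφ h
    | alice l d M hM next =>
      simp only [P.weight_succ_of_alice h]
      exact norm_inner_le_of_sum (x := ψ) (x' := φ)
        (y := fun k => TensorProduct.map (M k) LinearMap.id ψ)
        (y' := fun k => TensorProduct.map (M k) LinearMap.id φ)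
        (p := fun k => P.weight i N _ _ (next k) (TensorProduct.map (M k) LinearMap.id ψ))
        (q := fun k => P.weight j N _ _ (next k) (TensorProduct.map (M k) LinearMap.id φ))
        (sum_inner_map_left hM ψ ψ) (sum_inner_map_left hM φ φ) (sum_inner_map_left hM ψ φ)
        (fun k => P.weight_le _ _ _ _) (fun k => P.weight_le _ _ _ _)
        fun k => ih (hψ.of_alice h k) (hφ.of_alice h k)
    | bob l d M hM next =>
      simp only [P.weight_succ_of_bob h]
      exact norm_inner_le_of_sum (x := ψ) (x' := φ)
        (y := fun k => TensorProduct.map LinearMap.id (M k) ψ)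
        (y' := fun k => TensorProduct.map LinearMap.id (M k) φ)
        (p := fun k => P.weight i N _ _ (next k) (TensorProduct.map LinearMap.id (M k) ψ))
        (q := fun k => P.weight j N _ _ (next k) (TensorProduct.map LinearMap.id (M k) φ))
        (sum_inner_map_right hM ψ ψ) (sum_inner_map_right hM φ φ) (sum_inner_map_right hM ψ φ)
        (fun k => P.weight_le _ _ _ _) (fun k => P.weight_le _ _ _ _)
        fun k => ih (hψ.of_bob h k) (hφ.of_bob h k)

/-- States that are surely guessed apart are orthogonal. -/
theorem GuessesSurely.inner_eq_zero {i j : ι} (hij : i ≠ j) {a b : ℕ} {c : P.Conf a b}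
    {ψ φ : Bipartite a b} (hψ : P.GuessesSurely c i ψ) (hφ : P.GuessesSurely c j φ) :
    ⟪ψ, φ⟫_ℂ = 0 := by
  have h := ((hψ.const_sub (‖ψ‖ ^ 2)).sqrt.mul (hφ.const_sub (‖φ‖ ^ 2)).sqrt)
  simp only [sub_self, Real.sqrt_zero, mul_zero] at h
  exact norm_le_zero_iff.1 (ge_of_tendsto' h fun N => hψ.norm_inner_le hij N hφ)

end LOCCProtocol

/-! ### Criterion for indistinguishability. -/

theorem isSymmetric_adjoint_comp {a b : ℕ} (A : Qudit a →ₗ[ℂ] Qudit b) :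
    (LinearMap.adjoint A ∘ₗ A).IsSymmetric := fun x y => by
  simp [LinearMap.adjoint_inner_left, LinearMap.adjoint_inner_right]

theorem inner_map_map_of_adjoint_comp_eq_smul {m n a b : ℕ} {A : Qudit m →ₗ[ℂ] Qudit a}
    {B : Qudit n →ₗ[ℂ] Qudit b} {E : Qudit m →ₗ[ℂ] Qudit m} {F : Qudit n →ₗ[ℂ] Qudit n}
    (hA : LinearMap.adjoint A ∘ₗ A = E) (hB : LinearMap.adjoint B ∘ₗ B = F)
    (ψ φ : Bipartite m n) :
    ⟪TensorProduct.map A B ψ, TensorProduct.map A B φ⟫_ℂ = ⟪ψ, TensorProduct.map E F φ⟫_ℂ := by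
  rw [← LinearMap.adjoint_inner_right, TensorProduct.adjoint_map, ← LinearMap.comp_apply,
    ← TensorProduct.map_comp, hA, hB]

/-- If only the multiples of the identity preserve the orthogonality of the states in `S`, on
either side, then these states cannot be perfectly distinguished by LOCC. -/
theorem not_LOCCDistinguishable_of_trivial {m n : ℕ} {S : Set (Bipartite m n)}
    (hS : S.Nontrivial) (h0 : ∀ ψ ∈ S, ψ ≠ 0)
    (hleft : ∀ E : Qudit m →ₗ[ℂ] Qudit m, E.IsSymmetric →
      (∀ ψ ∈ S, ∀ φ ∈ S, ψ ≠ φ → ⟪ψ, TensorProduct.map E LinearMap.id φ⟫_ℂ = 0) →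
      ∃ x : ℂ, E = x • LinearMap.id)
    (hright : ∀ E : Qudit n →ₗ[ℂ] Qudit n, E.IsSymmetric →
      (∀ ψ ∈ S, ∀ φ ∈ S, ψ ≠ φ → ⟪ψ, TensorProduct.map LinearMap.id E φ⟫_ℂ = 0) →
      ∃ x : ℂ, E = x • LinearMap.id) :
    ¬ LOCCDistinguishable S := by
  rintro ⟨P, hP⟩
  have key (N : ℕ) : ∀ (a b : ℕ) (c : P.Conf a b) (A : Qudit m →ₗ[ℂ] Qudit a)
      (B : Qudit n →ₗ[ℂ] Qudit b) (x y : ℂ), LinearMap.adjoint A ∘ₗ A = x • LinearMap.id →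
      LinearMap.adjoint B ∘ₗ B = y • LinearMap.id →
      (∀ ψ ∈ S, P.GuessesSurely c ψ (TensorProduct.map A B ψ)) →
      ∀ ψ ∈ S, P.weight ψ N a b c (TensorProduct.map A B ψ) = 0 := by
    have inner_eq {a b : ℕ} {A : Qudit m →ₗ[ℂ] Qudit a} {B : Qudit n →ₗ[ℂ] Qudit b} {x y : ℂ}
        (hA : LinearMap.adjoint A ∘ₗ A = x • LinearMap.id)
        (hB : LinearMap.adjoint B ∘ₗ B = y • LinearMap.id) (ψ φ : Bipartite m n) :
        ⟪TensorProduct.map A B ψ, TensorProduct.map A B φ⟫_ℂ = x * y * ⟪ψ, φ⟫_ℂ := by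
      rw [inner_map_map_of_adjoint_comp_eq_smul hA hB, TensorProduct.map_smul_left,
        TensorProduct.map_smul_right]
      simp [inner_smul_right, mul_assoc]
    have map_eq_zero {a b : ℕ} {A : Qudit m →ₗ[ℂ] Qudit a} {B : Qudit n →ₗ[ℂ] Qudit b} {x y : ℂ}
        (hA : LinearMap.adjoint A ∘ₗ A = x • LinearMap.id)
        (hB : LinearMap.adjoint B ∘ₗ B = y • LinearMap.id) (hxy : x * y = 0)
        (ψ : Bipartite m n) : TensorProduct.map A B ψ = 0 := by
      rw [← inner_self_eq_zero (𝕜 := ℂ), inner_eq hA hB, hxy, zero_mul]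
    have weight_zero {a b : ℕ} (N : ℕ) (c : P.Conf a b) (ψ : Bipartite m n) :
        P.weight ψ N a b c 0 = 0 :=
      le_antisymm (by simpa using P.weight_le ψ N c 0) (P.weight_nonneg _ _ _ _)
    have halt {a b : ℕ} (N : ℕ) (c : P.Conf a b) {A : Qudit m →ₗ[ℂ] Qudit a}
        {B : Qudit n →ₗ[ℂ] Qudit b} {x y : ℂ} (hA : LinearMap.adjoint A ∘ₗ A = x • LinearMap.id)
        (hB : LinearMap.adjoint B ∘ₗ B = y • LinearMap.id)
        (hc : ∀ ψ ∈ S, P.GuessesSurely c ψ (TensorProduct.map A B ψ)) {g : Bipartite m n}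
        (h : P.step a b c = .halt g) (ψ : Bipartite m n) :
        P.weight ψ N a b c (TensorProduct.map A B ψ) = 0 := by
      -- Whatever the guess, some state of `S` is different from it and must have been annihilated;
      -- proportionality of inner products then forces `x * y = 0`, so all states are annihilated.
      obtain ⟨φ, hφ, hφg⟩ := hS.exists_ne g
      have hφ' := ((hc φ hφ).of_halt h).resolve_left hφg.symm
      have := inner_eq hA hB φ φ
      rw [hφ', inner_zero_left] at this
      rw [map_eq_zero hA hB ((mul_eq_zero.1 this.symm).resolve_right
        (inner_self_ne_zero.2 (h0 φ hφ))), weight_zero]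
    induction N with
    | zero =>
      intro a b c A B x y hA hB hc ψ hψ
      cases h : P.step a b c with
      | halt g => exact halt 0 c hA hB hc h ψ
      | alice => exact P.weight_zero_of_alice h _ _
      | bob => exact P.weight_zero_of_bob h _ _
    | succ N ih =>
      intro a b c A B x y hA hB hc ψ hψ
      cases h : P.step a b c with
      | halt g => exact halt _ c hA hB hc h ψ
      | alice l d M hM next =>
        -- A zero factor kills the branch; a nonzero one can be cancelled below, leaving an
        -- orthogonality condition on the measuring side alone.
        by_cases hy : y = 0
        · rw [map_eq_zero hA hB (by simp [hy]), weight_zero]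
        rw [P.weight_succ_of_alice h]
        refine Finset.sum_eq_zero fun k _ => ?_
        have hcomp (ψ : Bipartite m n) : TensorProduct.map (M k) LinearMap.id
            (TensorProduct.map A B ψ) = TensorProduct.map (M k ∘ₗ A) B ψ := by
          rw [← LinearMap.comp_apply, ← TensorProduct.map_comp, LinearMap.id_comp]
        have hk (ψ) (hψ : ψ ∈ S) := (hc ψ hψ).of_alice h k
        simp only [hcomp] at hk ⊢
        obtain ⟨z, hz⟩ := hleft _ (isSymmetric_adjoint_comp (M k ∘ₗ A)) fun ψ hψ φ hφ hne => by
          have := (hk ψ hψ).inner_eq_zero hne (hk φ hφ)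
          rw [inner_map_map_of_adjoint_comp_eq_smul rfl hB, TensorProduct.map_smul_right,
            LinearMap.smul_apply, inner_smul_right] at this
          exact (mul_eq_zero.1 this).resolve_left hy
        exact ih _ _ _ _ _ z y hz hB hk ψ hψ
      | bob l d M hM next =>
        by_cases hx : x = 0
        · rw [map_eq_zero hA hB (by simp [hx]), weight_zero]
        rw [P.weight_succ_of_bob h]
        refine Finset.sum_eq_zero fun k _ => ?_
        have hcomp (ψ : Bipartite m n) : TensorProduct.map LinearMap.id (M k)
            (TensorProduct.map A B ψ) = TensorProduct.map A (M k ∘ₗ B) ψ := by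
          rw [← LinearMap.comp_apply, ← TensorProduct.map_comp, LinearMap.id_comp]
        have hk (ψ) (hψ : ψ ∈ S) := (hc ψ hψ).of_bob h k
        simp only [hcomp] at hk ⊢
        obtain ⟨z, hz⟩ := hright _ (isSymmetric_adjoint_comp (M k ∘ₗ B)) fun ψ hψ φ hφ hne => by
          have := (hk ψ hψ).inner_eq_zero hne (hk φ hφ)
          rw [inner_map_map_of_adjoint_comp_eq_smul hA rfl, TensorProduct.map_smul_left,
            LinearMap.smul_apply, inner_smul_right] at this
          exact (mul_eq_zero.1 this).resolve_left hx
        exact ih _ _ _ _ _ x z hA hz hk ψ hψ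
  have hnorm (ψ) (hψ : ψ ∈ S) : ‖ψ‖ ^ 2 ≠ 0 := by simpa using h0 ψ hψ
  have hstart : ∀ ψ ∈ S, P.GuessesSurely P.start ψ ψ := fun ψ hψ => by
    have := (hP ψ hψ).mul_const (‖ψ‖ ^ 2)
    simpa [LOCCProtocol.prob, div_mul_cancel₀ _ (hnorm ψ hψ), LOCCProtocol.GuessesSurely] using this
  obtain ⟨ψ, hψ⟩ := hS.nonempty
  have hw (N : ℕ) : P.weight ψ N m n P.start ψ = 0 := by
    simpa using key N m n P.start LinearMap.id LinearMap.id 1 1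
      (by ext; simp) (by ext; simp) (by simpa using hstart) ψ hψ
  have := hstart ψ hψ
  simp only [LOCCProtocol.GuessesSurely, hw] at this
  exact hnorm ψ hψ (tendsto_nhds_unique this tendsto_const_nhds)

/-! ### Computational basis and blocks. -/

theorem ket_apply (d i : ℕ) (k : Fin d) : ket d i k = if (k : ℕ) = i then 1 else 0 := rfl

theorem inner_ket_left {d i : ℕ} (hi : i < d) (v : Qudit d) : ⟪ket d i, v⟫_ℂ = v ⟨i, hi⟩ := by
  rw [PiLp.inner_apply, Finset.sum_eq_single ⟨i, hi⟩]
  · simp [ket_apply]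
  · intro k _ hk
    simp [ket_apply, Fin.val_ne_of_ne hk]
  · simp

theorem inner_ket_ket {d i j : ℕ} (hi : i < d) : ⟪ket d i, ket d j⟫_ℂ = if i = j then 1 else 0 := by
  rw [inner_ket_left hi, ket_apply]

theorem ket_ne_zero {d i : ℕ} (hi : i < d) : ket d i ≠ 0 := fun h => by
  have := inner_ket_ket (j := i) hi
  simp [h] at this

theorem eq_top_of_ket_mem {d : ℕ} {W : Submodule ℂ (Qudit d)} (h : ∀ i < d, ket d i ∈ W) :
    W = ⊤ := by
  rw [eq_top_iff, ← (EuclideanSpace.basisFun (Fin d) ℂ).toBasis.span_eq, Submodule.span_le]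
  rintro _ ⟨i, rfl⟩
  convert SetLike.mem_coe.2 (h i i.2)
  ext k
  simp [ket_apply, Fin.ext_iff]

theorem ne_of_inner_eq_zero {E : Type*} [NormedAddCommGroup E] [InnerProductSpace ℂ E] {x y : E}
    (hx : x ≠ 0) (h : ⟪x, y⟫_ℂ = 0) : x ≠ y := by
  rintro rfl
  exact hx (inner_self_eq_zero.1 h)

theorem inner_eq_zero_of_disjoint_support {d : ℕ} {v w : Qudit d}
    (h : ∀ k, v k ≠ 0 → w k ≠ 0 → False) : ⟪v, w⟫_ℂ = 0 := by
  rw [PiLp.inner_apply]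
  refine Finset.sum_eq_zero fun k _ => ?_
  by_cases hv : v k = 0
  · simp [hv]
  · simp [show w k = 0 from by_contra (h k hv)]

/-- `V` is an orthogonal basis of the span of `|p⟩, …, |q-1⟩` and its elements have no zero
coordinate there. -/
structure IsBlock (d p q : ℕ) (V : Set (Qudit d)) : Prop where
  ne_zero_iff : ∀ v ∈ V, ∀ k : Fin d, v k ≠ 0 ↔ p ≤ k ∧ k < q
  inner_eq_zero : ∀ v ∈ V, ∀ w ∈ V, v ≠ w → ⟪v, w⟫_ℂ = 0
  ket_mem_span : ∀ k, p ≤ k → k < q → ket d k ∈ Submodule.span ℂ V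

theorem IsBlock.inner_eq_zero_of_le {d p q p' q' : ℕ} {V V' : Set (Qudit d)} (hV : IsBlock d p q V)
    (hV' : IsBlock d p' q' V') (h : q ≤ p' ∨ q' ≤ p) {v w : Qudit d} (hv : v ∈ V) (hw : w ∈ V') :
    ⟪v, w⟫_ℂ = 0 :=
  inner_eq_zero_of_disjoint_support fun k hk hk' => by
    rw [hV.ne_zero_iff v hv] at hk
    rw [hV'.ne_zero_iff w hw] at hk'
    omega

theorem isBlock_pairVectors {d i : ℕ} (hi : i + 1 < d) : IsBlock d i (i + 2) (pairVectors d i) where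
  ne_zero_iff := by
    rintro v (rfl | rfl) k <;> simp only [PiLp.add_apply, PiLp.sub_apply, ket_apply] <;>
      split_ifs <;> simp <;> omega
  inner_eq_zero := by
    have hi' : i < d := by omega
    rintro v (rfl | rfl) w (rfl | rfl) hvw
    · exact (hvw rfl).elim
    · simp only [inner_add_left, inner_sub_right, inner_ket_ket hi, inner_ket_ket hi']
      simp
    · simp only [inner_sub_left, inner_add_right, inner_ket_ket hi, inner_ket_ket hi']
      simp
    · exact (hvw rfl).elim
  ket_mem_span := by
    intro k hk hk'
    have h1 : ket d i + ket d (i + 1) ∈ Submodule.span ℂ (pairVectors d i) :=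
      Submodule.subset_span (.inl rfl)
    have h2 : ket d i - ket d (i + 1) ∈ Submodule.span ℂ (pairVectors d i) :=
      Submodule.subset_span (.inr rfl)
    obtain rfl | rfl : k = i ∨ k = i + 1 := by omega
    · convert Submodule.smul_mem _ (1 / 2 : ℂ) (Submodule.add_mem _ h1 h2) using 1
      module
    · convert Submodule.smul_mem _ (1 / 2 : ℂ) (Submodule.sub_mem _ h1 h2) using 1
      module

theorem exists_cube_root : ∃ ω : ℂ, Complex.exp (2 * Real.pi * Complex.I / 3) = ω ∧
    1 + ω + ω ^ 2 = 0 ∧ starRingEnd ℂ ω = ω ^ 2 ∧ ω ≠ 0 := by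
  refine ⟨_, rfl, ?_⟩
  have h := Complex.isPrimitiveRoot_exp 3 (by norm_num)
  push_cast at h
  set ω := Complex.exp (2 * Real.pi * Complex.I / 3)
  have h3 : ω ^ 3 = 1 := h.pow_eq_one
  refine ⟨?_, ?_, Complex.exp_ne_zero _⟩
  · have := h.geom_sum_eq_zero (by norm_num)
    simpa [Finset.sum_range_succ] using this
  · have h1 : ω * starRingEnd ℂ ω = 1 := by
      rw [Complex.mul_conj, Complex.normSq_eq_norm_sq, h.norm'_eq_one (by norm_num)]
      norm_num
    linear_combination ω ^ 2 * h1 - starRingEnd ℂ ω * h3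

theorem isBlock_tripleVectors {d i : ℕ} (hi : i + 2 < d) :
    IsBlock d i (i + 3) (tripleVectors d i) := by
  obtain ⟨ω, hω, hsum, hconj, h0⟩ := exists_cube_root
  have h3 : ω ^ 3 = 1 := by linear_combination (ω - 1) * hsum
  have hi0 : i < d := by omega
  have hi1 : i + 1 < d := by omega
  simp only [tripleVectors, hω]
  constructor
  · rintro v ⟨t, -, rfl⟩ k
    simp only [Finset.sum_range_succ, Finset.sum_range_zero, PiLp.add_apply, PiLp.smul_apply,
      ket_apply, PiLp.zero_apply]
    split_ifs <;> simp [h0] <;> omega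
  · rintro v ⟨t, ht, rfl⟩ w ⟨t', ht', rfl⟩ hvw
    have htt : t ≠ t' := by rintro rfl; exact hvw rfl
    clear hvw
    simp only [Finset.sum_range_succ, Finset.sum_range_zero, zero_add, add_zero,
      inner_add_left,
      inner_add_right, inner_smul_left, inner_smul_right, inner_ket_ket hi0, inner_ket_ket hi1,
      inner_ket_ket hi, map_pow, hconj]
    interval_cases t <;> interval_cases t' <;> simp at htt ⊢
    · linear_combination hsum
    · linear_combination hsum + ω * h3
    · linear_combination hsum + ω * h3
    · linear_combination hsum + (ω + ω ^ 2 * (ω ^ 3 + 1)) * h3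
    · linear_combination hsum + (ω + ω ^ 2 * (ω ^ 3 + 1)) * h3
    · linear_combination hsum + (ω ^ 2 + ω * (ω ^ 6 + ω ^ 3 + 1)) * h3
  · intro k hk hk'
    have hmem (t : ℕ) (ht : t < 3) := Submodule.subset_span (R := ℂ)
      (show ∑ j ∈ Finset.range 3, ω ^ (t * j) • ket d (i + j) ∈ {v | ∃ t < 3, v =
        ∑ j ∈ Finset.range 3, ω ^ (t * j) • ket d (i + j)} from ⟨t, ht, rfl⟩)
    have hm0 := hmem 0 (by norm_num)
    have hm1 := hmem 1 (by norm_num)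
    have hm2 := hmem 2 (by norm_num)
    have hm (x y z : ℂ) := Submodule.add_mem _ (Submodule.add_mem _ (Submodule.smul_mem _ x hm0)
      (Submodule.smul_mem _ y hm1)) (Submodule.smul_mem _ z hm2)
    obtain rfl | rfl | rfl : k = i ∨ k = i + 1 ∨ k = i + 2 := by omega
    -- The coefficients here and in the next two cases are those of the inverse discrete Fourier
    -- transform of order three.
    · convert hm (1 / 3) (1 / 3) (1 / 3) using 1
      simp only [Finset.sum_range_succ, Finset.sum_range_zero]
      match_scalars
      · ring
      · linear_combination -1 / 3 * hsum
      · linear_combination -1 / 3 * hsum - ω / 3 * h3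
    · convert hm (1 / 3) (ω ^ 2 / 3) (ω / 3) using 1
      simp only [Finset.sum_range_succ, Finset.sum_range_zero]
      match_scalars
      · linear_combination -2 / 3 * h3
      · linear_combination -1 / 3 * hsum
      · linear_combination -1 / 3 * hsum - (ω + ω ^ 2) / 3 * h3
    · convert hm (1 / 3) (ω / 3) (ω ^ 2 / 3) using 1
      simp only [Finset.sum_range_succ, Finset.sum_range_zero]
      match_scalars
      · linear_combination -(2 + ω ^ 3) / 3 * h3
      · linear_combination -1 / 3 * hsum
      · linear_combination -1 / 3 * hsum - ω / 3 * h3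

/-! ### The edge families as unions of blocks. -/

section EdgeVectors

variable {d s : ℕ}

theorem mem_edgeVectors_of_odd (h : Odd d) {v : Qudit d} :
    v ∈ edgeVectors d s ↔ ∃ δ < (d - 1) / 2, v ∈ pairVectors d (s + 2 * δ) := by
  rw [edgeVectors, if_pos h, Set.mem_ofPred_eq]

theorem mem_edgeVectors_of_not_odd (h : ¬ Odd d) {v : Qudit d} :
    v ∈ edgeVectors d s ↔ v ∈ tripleVectors d s ∨
      ∃ δ < d / 2 - 2, v ∈ pairVectors d (s + 3 + 2 * δ) := by
  rw [edgeVectors, if_neg h]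
  rfl

theorem exists_isBlock_of_mem_edgeVectors (hd : 3 ≤ d) (hs : s ≤ 1) {v : Qudit d}
    (hv : v ∈ edgeVectors d s) :
    ∃ p q V, IsBlock d p q V ∧ v ∈ V ∧ s ≤ p ∧ p < q ∧ q ≤ s + (d - 1) := by
  by_cases h : Odd d
  · obtain ⟨δ, hδ, hv⟩ := (mem_edgeVectors_of_odd h).1 hv
    exact ⟨_, _, _, isBlock_pairVectors (by omega), hv, by omega, by omega, by omega⟩
  · have := Nat.not_odd_iff.1 h
    obtain hv | ⟨δ, hδ, hv⟩ := (mem_edgeVectors_of_not_odd h).1 hv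
    · exact ⟨_, _, _, isBlock_tripleVectors (by omega), hv, by omega, by omega, by omega⟩
    · exact ⟨_, _, _, isBlock_pairVectors (by omega), hv, by omega, by omega, by omega⟩

theorem edgeVectors_ne_zero (hd : 3 ≤ d) (hs : s ≤ 1) {v : Qudit d} (hv : v ∈ edgeVectors d s) :
    v ≠ 0 := by
  obtain ⟨p, q, V, hV, hvV, hp, hpq, hq⟩ := exists_isBlock_of_mem_edgeVectors hd hs hv
  rintro rfl
  exact (hV.ne_zero_iff _ hvV ⟨p, by omega⟩).2 ⟨le_rfl, hpq⟩ rfl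

theorem inner_ket_edgeVectors (hd : 3 ≤ d) (hs : s ≤ 1) {v : Qudit d} (hv : v ∈ edgeVectors d s)
    {k : ℕ} (hkd : k < d) (hk : k < s ∨ s + (d - 1) ≤ k) : ⟪ket d k, v⟫_ℂ = 0 := by
  obtain ⟨p, q, V, hV, hvV, hp, hpq, hq⟩ := exists_isBlock_of_mem_edgeVectors hd hs hv
  rw [inner_ket_left hkd]
  have := (hV.ne_zero_iff _ hvV ⟨k, hkd⟩)
  by_contra h
  have := this.1 h
  dsimp only at this
  omega

theorem edgeVectors_inner_eq_zero (hd : 3 ≤ d) (hs : s ≤ 1) {v w : Qudit d}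
    (hv : v ∈ edgeVectors d s) (hw : w ∈ edgeVectors d s) (hvw : v ≠ w) : ⟪v, w⟫_ℂ = 0 := by
  by_cases h : Odd d
  · obtain ⟨δ, hδ, hv⟩ := (mem_edgeVectors_of_odd h).1 hv
    obtain ⟨δ', hδ', hw⟩ := (mem_edgeVectors_of_odd h).1 hw
    rcases eq_or_ne δ δ' with rfl | hne
    · exact (isBlock_pairVectors (by omega)).inner_eq_zero v hv w hw hvw
    · exact (isBlock_pairVectors (by omega)).inner_eq_zero_of_le (isBlock_pairVectors (by omega))
        (by omega) hv hw
  · have := Nat.not_odd_iff.1 h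
    obtain hv | ⟨δ, hδ, hv⟩ := (mem_edgeVectors_of_not_odd h).1 hv <;>
      obtain hw | ⟨δ', hδ', hw⟩ := (mem_edgeVectors_of_not_odd h).1 hw
    · exact (isBlock_tripleVectors (by omega)).inner_eq_zero v hv w hw hvw
    · exact (isBlock_tripleVectors (by omega)).inner_eq_zero_of_le (isBlock_pairVectors (by omega))
        (by omega) hv hw
    · exact (isBlock_pairVectors (by omega)).inner_eq_zero_of_le (isBlock_tripleVectors (by omega))
        (by omega) hv hw
    · rcases eq_or_ne δ δ' with rfl | hne
      · exact (isBlock_pairVectors (by omega)).inner_eq_zero v hv w hw hvw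
      · exact (isBlock_pairVectors (by omega)).inner_eq_zero_of_le (isBlock_pairVectors (by omega))
          (by omega) hv hw

theorem pairVectors_subset_edgeVectors_of_odd (h : Odd d) {i δ : ℕ} (hi : i = s + 2 * δ)
    (hδ : δ < (d - 1) / 2) : pairVectors d i ⊆ edgeVectors d s := fun _ hv =>
  (mem_edgeVectors_of_odd h).2 ⟨δ, hδ, hi ▸ hv⟩

theorem pairVectors_subset_edgeVectors_of_not_odd (h : ¬ Odd d) {i δ : ℕ}
    (hi : i = s + 3 + 2 * δ) (hδ : δ < d / 2 - 2) : pairVectors d i ⊆ edgeVectors d s := fun _ hv =>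
  (mem_edgeVectors_of_not_odd h).2 (.inr ⟨δ, hδ, hi ▸ hv⟩)

theorem tripleVectors_subset_edgeVectors (h : ¬ Odd d) : tripleVectors d s ⊆ edgeVectors d s :=
  fun _ hv => (mem_edgeVectors_of_not_odd h).2 (.inl hv)

theorem ket_mem_span_edgeVectors (hd : 3 ≤ d) (hs : s ≤ 1) {k : ℕ} (hk : s ≤ k)
    (hk' : k < s + (d - 1)) : ket d k ∈ Submodule.span ℂ (edgeVectors d s) := by
  by_cases h : Odd d
  · have := Nat.odd_iff.1 h
    exact Submodule.span_mono
      (pairVectors_subset_edgeVectors_of_odd (i := s + 2 * ((k - s) / 2)) h rfl (by omega))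
      ((isBlock_pairVectors (by omega)).ket_mem_span k (by omega) (by omega))
  · have := Nat.not_odd_iff.1 h
    by_cases hk3 : k < s + 3
    · exact Submodule.span_mono (tripleVectors_subset_edgeVectors h)
        ((isBlock_tripleVectors (by omega)).ket_mem_span k hk hk3)
    · exact Submodule.span_mono (pairVectors_subset_edgeVectors_of_not_odd
          (i := s + 3 + 2 * ((k - s - 3) / 2)) h rfl (by omega))
        ((isBlock_pairVectors (by omega)).ket_mem_span k (by omega) (by omega))

/-- Neighbouring basis vectors belong to the same block of one of the two families. -/
theorem exists_isBlock_of_succ_lt {i : ℕ} (hi : i + 1 < d) (hd : 3 ≤ d) :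
    ∃ s ≤ 1, ∃ p q, ∃ V ⊆ edgeVectors d s, IsBlock d p q V ∧ p ≤ i ∧ i + 1 < q := by
  by_cases h : Odd d
  · have := Nat.odd_iff.1 h
    -- Pairs of the family `s` start at indices of the parity of `s`, so parity selects the family.
    exact ⟨i % 2, by omega, i, _, _,
      pairVectors_subset_edgeVectors_of_odd (δ := i / 2) h (by omega) (by omega),
      isBlock_pairVectors hi, le_rfl, by omega⟩
  · have := Nat.not_odd_iff.1 h
    -- The triple at 0 links 0, 1, 2 and the triple at 1 supplies the link from 2 to 3, hence `i /
    -- 2`. Beyond that, pairs start at `s + 3 + 2δ`, so the parity rule is reversed.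
    by_cases h3 : i < 3
    · exact ⟨i / 2, by omega, _, _, _, tripleVectors_subset_edgeVectors h,
        isBlock_tripleVectors (by omega), by omega, by omega⟩
    · exact ⟨1 - i % 2, by omega, i, _, _,
        pairVectors_subset_edgeVectors_of_not_odd (δ := (i - 3) / 2) h (by omega) (by omega),
        isBlock_pairVectors hi, le_rfl, by omega⟩

/-- Otherwise the ket would be orthogonal to a span that contains it. -/
theorem exists_edgeVector_inner_ket_ne_zero (hd : 3 ≤ d) (hs : s ≤ 1) {k : ℕ} (hk : s ≤ k)
    (hk' : k < s + (d - 1)) : ∃ v ∈ edgeVectors d s, ⟪v, ket d k⟫_ℂ ≠ 0 := by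
  by_contra! h
  have : ket d k ∈ (ℂ ∙ ket d k)ᗮ := by
    refine Submodule.span_le.2 (fun v hv => ?_) (ket_mem_span_edgeVectors hd hs hk hk')
    rw [SetLike.mem_coe, Submodule.mem_orthogonal_singleton_iff_inner_left]
    exact h v hv
  rw [Submodule.mem_orthogonal_singleton_iff_inner_left] at this
  exact ket_ne_zero (by omega) (inner_self_eq_zero.1 this)

end EdgeVectors

/-! ### Rigidity of Hermitian maps that preserve orthogonality on the edges. -/

/-- After subtracting its projection onto `v`, the vector `E v` is orthogonal to all of `B`, hence
to everything, itself included. -/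
theorem exists_eigenvalue_of_orthogonal {V : Type*} [NormedAddCommGroup V] [InnerProductSpace ℂ V]
    {B : Set V} (hB : Submodule.span ℂ B = ⊤) (E : V →ₗ[ℂ] V) {v : V} (hv : v ≠ 0)
    (h : ∀ w ∈ B, w ≠ v → ⟪w, v⟫_ℂ = 0 ∧ ⟪w, E v⟫_ℂ = 0) : ∃ μ : ℂ, E v = μ • v := by
  have hvv : ⟪v, v⟫_ℂ ≠ 0 := inner_self_ne_zero.2 hv
  refine ⟨⟪v, E v⟫_ℂ / ⟪v, v⟫_ℂ, sub_eq_zero.1 ?_⟩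
  set y := E v - (⟪v, E v⟫_ℂ / ⟪v, v⟫_ℂ) • v with hy
  have hmem (w) (hw : w ∈ B) : w ∈ (ℂ ∙ y)ᗮ := by
    rw [Submodule.mem_orthogonal_singleton_iff_inner_left, hy, inner_sub_right, inner_smul_right]
    rcases eq_or_ne w v with rfl | hne
    · field_simp
      ring
    · simp [h w hw hne]
  have hy' : y ∈ (ℂ ∙ y)ᗮ :=
    (Submodule.span_le.2 hmem) (show y ∈ Submodule.span ℂ B by rw [hB]; trivial)
  rw [Submodule.mem_orthogonal_singleton_iff_inner_left] at hy'
  exact inner_self_eq_zero.1 hy'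

theorem LinearMap.IsSymmetric.eq_of_inner_ne_zero {V : Type*} [NormedAddCommGroup V]
    [InnerProductSpace ℂ V] {E : V →ₗ[ℂ] V} (hE : E.IsSymmetric) {v w : V} {μ ν : ℂ}
    (hv : E v = μ • v) (hw : E w = ν • w) (h : ⟪v, w⟫_ℂ ≠ 0) : μ = ν := by
  have hv0 : v ≠ 0 := by rintro rfl; simp at h
  have hμ : starRingEnd ℂ μ = μ := by
    have := hE v v
    rw [hv, inner_smul_left, inner_smul_right] at this
    exact mul_right_cancel₀ (inner_self_ne_zero.2 hv0) this
  have := hE v w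
  rw [hv, hw, inner_smul_left, inner_smul_right, hμ] at this
  exact mul_right_cancel₀ h this

theorem exists_eq_smul_id_of_edgeVectors {d : ℕ} (hd : 3 ≤ d) {E : Qudit d →ₗ[ℂ] Qudit d}
    (hE : E.IsSymmetric)
    (h : ∀ s ≤ 1, ∀ v ∈ edgeVectors d s, ∀ w ∈ edgeVectors d s, v ≠ w → ⟪v, E w⟫_ℂ = 0)
    (h0 : ∀ v ∈ edgeVectors d 1, ⟪ket d 0, E v⟫_ℂ = 0)
    (hlast : ∀ v ∈ edgeVectors d 0, ⟪ket d (d - 1), E v⟫_ℂ = 0) :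
    ∃ x : ℂ, E = x • LinearMap.id := by
  -- The index `(1 - s) * (d - 1)` names the one ket that the family misses: the last for `s = 0`,
  -- the first for `s = 1`.
  have hspan (s : ℕ) (hs : s ≤ 1) :
      Submodule.span ℂ (insert (ket d ((1 - s) * (d - 1))) (edgeVectors d s)) = ⊤ := by
    refine eq_top_of_ket_mem fun i hi => ?_
    by_cases his : i = (1 - s) * (d - 1)
    · exact Submodule.subset_span (.inl (by rw [his]))
    · refine Submodule.span_mono (Set.subset_insert _ _) (ket_mem_span_edgeVectors hd hs ?_ ?_) <;>
        interval_cases s <;> simp at his ⊢ <;> omega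
  have hedge (s : ℕ) (hs : s ≤ 1) (v) (hv : v ∈ edgeVectors d s) : ∃ μ : ℂ, E v = μ • v := by
    refine exists_eigenvalue_of_orthogonal (hspan s hs) E (edgeVectors_ne_zero hd hs hv) ?_
    rintro w (rfl | hw) hne
    · refine ⟨inner_ket_edgeVectors hd hs hv ?_ ?_, ?_⟩ <;> interval_cases s <;> simp
      · omega
      · omega
      · exact hlast v hv
      · exact h0 v hv
    · exact ⟨edgeVectors_inner_eq_zero hd hs hw hv hne, h s hs w hw v hv hne⟩
  obtain ⟨x, hx⟩ : ∃ x : ℂ, E (ket d 0) = x • ket d 0 := by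
    refine exists_eigenvalue_of_orthogonal (hspan 1 le_rfl) E (ket_ne_zero (by omega)) ?_
    rintro w (rfl | hw) hne
    · simp at hne
    · rw [← hE, inner_eq_zero_symm, inner_eq_zero_symm (x := E w)]
      exact ⟨inner_ket_edgeVectors hd le_rfl hw (by omega) (by omega), h0 w hw⟩
  have hket (i : ℕ) (hi : i < d) : ket d i ∈ LinearMap.ker (E - x • LinearMap.id) := by
    induction i with
    | zero => simp [hx]
    | succ i ih =>
      have hi' : E (ket d i) = x • ket d i := by simpa [sub_eq_zero] using ih (by omega)
      obtain ⟨s, hs, p, q, V, hVs, hV, hp, hq⟩ := exists_isBlock_of_succ_lt hi hd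
      -- Every vector of the block has a nonzero coordinate at `i`, so it shares the eigenvalue `x`
      -- of `ket d i`; the block spans `ket d (i + 1)`.
      refine Submodule.span_le.2 (fun v hv => ?_) (hV.ket_mem_span (i + 1) (by omega) hq)
      obtain ⟨μ, hμ⟩ := hedge s hs v (hVs hv)
      have hne : ⟪ket d i, v⟫_ℂ ≠ 0 := by
        rw [inner_ket_left (by omega), hV.ne_zero_iff v hv]
        exact ⟨hp, by dsimp only; omega⟩
      simp [hμ, hE.eq_of_inner_ne_zero hi' hμ hne]
  exact ⟨x, sub_eq_zero.1 (LinearMap.ker_eq_top.1 (eq_top_of_ket_mem hket))⟩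

/-! ### The boundary and interior states in the grid. -/

section Boundary

variable {m n : ℕ}

theorem boundarySet_union_interiorSet_inner_eq_zero (hm : 3 ≤ m) (hn : 3 ≤ n) {ψ φ : Bipartite m n}
    (hψ : ψ ∈ boundarySet m n ∪ interiorSet m n) (hφ : φ ∈ boundarySet m n ∪ interiorSet m n)
    (hne : ψ ≠ φ) : ⟪ψ, φ⟫_ℂ = 0 := by
  have first {d : ℕ} (hd : 3 ≤ d) (u) (hu : u ∈ edgeVectors d 1) :
      ⟪ket d 0, u⟫_ℂ = 0 ∧ ⟪u, ket d 0⟫_ℂ = 0 := by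
    rw [inner_eq_zero_symm (x := u), and_self]
    exact inner_ket_edgeVectors hd le_rfl hu (by omega) (by omega)
  have last {d : ℕ} (hd : 3 ≤ d) (u) (hu : u ∈ edgeVectors d 0) :
      ⟪ket d (d - 1), u⟫_ℂ = 0 ∧ ⟪u, ket d (d - 1)⟫_ℂ = 0 := by
    rw [inner_eq_zero_symm (x := u), and_self]
    exact inner_ket_edgeVectors hd zero_le_one hu (by omega) (by omega)
  have ends {d : ℕ} (hd : 3 ≤ d) :
      ⟪ket d 0, ket d (d - 1)⟫_ℂ = 0 ∧ ⟪ket d (d - 1), ket d 0⟫_ℂ = 0 := by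
    constructor <;> rw [inner_ket_ket (by omega), if_neg (by omega)]
  have inner0 {d i : ℕ} (hd : 3 ≤ d) (hi : 1 ≤ i) (hi' : i ≤ d - 2) :
      ⟪ket d 0, ket d i⟫_ℂ = 0 ∧ ⟪ket d i, ket d 0⟫_ℂ = 0 := by
    constructor <;> rw [inner_ket_ket (by omega), if_neg (by omega)]
  have inner1 {d i : ℕ} (hd : 3 ≤ d) (hi : 1 ≤ i) (hi' : i ≤ d - 2) :
      ⟪ket d (d - 1), ket d i⟫_ℂ = 0 ∧ ⟪ket d i, ket d (d - 1)⟫_ℂ = 0 := by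
    constructor <;> rw [inner_ket_ket (by omega), if_neg (by omega)]
  have edge {d s : ℕ} (hd : 3 ≤ d) (hs : s ≤ 1) {u v} (hu : u ∈ edgeVectors d s)
      (hv : v ∈ edgeVectors d s) (huv : u ≠ v) : ⟪u, v⟫_ℂ = 0 :=
    edgeVectors_inner_eq_zero hd hs hu hv huv
  rcases hψ with (((⟨v, hv, rfl⟩ | ⟨u, hu, rfl⟩) | ⟨v, hv, rfl⟩) | ⟨u, hu, rfl⟩) |
      ⟨i, j, hi, hi', hj, hj', rfl⟩ <;>
    rcases hφ with (((⟨v', hv', rfl⟩ | ⟨u', hu', rfl⟩) | ⟨v', hv', rfl⟩) | ⟨u', hu', rfl⟩) |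
      ⟨i', j', hk, hk', hl, hl', rfl⟩
  -- The five named cases compare states of one family. In every mixed case the positions in the
  -- grid already make one tensor factor orthogonal.
  case inl.inl.inl.inl.inl.inl.inl.inl =>
    rw [TensorProduct.inner_tmul, edge hn zero_le_one hv hv' (by rintro rfl; exact hne rfl),
      mul_zero]
  case inl.inl.inl.inr.inl.inl.inl.inr =>
    rw [TensorProduct.inner_tmul, edge hm zero_le_one hu hu' (by rintro rfl; exact hne rfl),
      zero_mul]
  case inl.inl.inr.inl.inl.inr =>
    rw [TensorProduct.inner_tmul, edge hn le_rfl hv hv' (by rintro rfl; exact hne rfl),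
      mul_zero]
  case inl.inr.inl.inr =>
    rw [TensorProduct.inner_tmul, edge hm le_rfl hu hu' (by rintro rfl; exact hne rfl),
      zero_mul]
  case inr.inr =>
    rw [TensorProduct.inner_tmul, inner_ket_ket (by omega), inner_ket_ket (by omega)]
    split_ifs with h1 h2
    · subst h1 h2; exact (hne rfl).elim
    all_goals simp
  all_goals rw [TensorProduct.inner_tmul, mul_eq_zero]
  all_goals
    simp only [first hm, first hn, last hm, last hn, ends hm, ends hn, inner0 hm, inner1 hm,
      inner0 hn, inner1 hn, true_or, or_true, *]

theorem isProductState_tmul {u : Qudit m} {v : Qudit n} (hu : u ≠ 0) (hv : v ≠ 0) :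
    IsProductState (u ⊗ₜ[ℂ] v) := by
  refine ⟨?_, u, v, rfl⟩
  rw [← norm_ne_zero_iff, TensorProduct.norm_tmul]
  exact mul_ne_zero (norm_ne_zero_iff.2 hu) (norm_ne_zero_iff.2 hv)

theorem isOrthogonalProductSet_boundarySet_union_interiorSet (hm : 3 ≤ m) (hn : 3 ≤ n) :
    IsOrthogonalProductSet (boundarySet m n ∪ interiorSet m n) := by
  refine ⟨?_, fun ψ hψ φ hφ => boundarySet_union_interiorSet_inner_eq_zero hm hn hψ hφ⟩
  rintro ψ ((((⟨v, hv, rfl⟩ | ⟨u, hu, rfl⟩) | ⟨v, hv, rfl⟩) | ⟨u, hu, rfl⟩) |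
      ⟨i, j, hi, hi', hj, hj', rfl⟩)
  · exact isProductState_tmul (ket_ne_zero (by omega)) (edgeVectors_ne_zero hn (by omega) hv)
  · exact isProductState_tmul (edgeVectors_ne_zero hm (by omega) hu) (ket_ne_zero (by omega))
  · exact isProductState_tmul (ket_ne_zero (by omega)) (edgeVectors_ne_zero hn (by omega) hv)
  · exact isProductState_tmul (edgeVectors_ne_zero hm (by omega) hu) (ket_ne_zero (by omega))
  · exact isProductState_tmul (ket_ne_zero (by omega)) (ket_ne_zero (by omega))

theorem eq_top_of_ket_tmul_ket_mem {W : Submodule ℂ (Bipartite m n)}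
    (h : ∀ i < m, ∀ j < n, ket m i ⊗ₜ[ℂ] ket n j ∈ W) : W = ⊤ := by
  have h1 (i) (hi : i < m) (y : Qudit n) : ket m i ⊗ₜ[ℂ] y ∈ W := by
    have : W.comap (TensorProduct.mk ℂ (Qudit m) (Qudit n) (ket m i)) = ⊤ :=
      eq_top_of_ket_mem (h i hi)
    exact (this ▸ Submodule.mem_top : y ∈ W.comap (TensorProduct.mk ℂ _ _ (ket m i)))
  have h2 (x : Qudit m) (y : Qudit n) : x ⊗ₜ[ℂ] y ∈ W := by
    have : W.comap ((TensorProduct.mk ℂ (Qudit m) (Qudit n)).flip y) = ⊤ :=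
      eq_top_of_ket_mem fun i hi => h1 i hi y
    exact (this ▸ Submodule.mem_top : x ∈ W.comap ((TensorProduct.mk ℂ _ _).flip y))
  rw [eq_top_iff, ← TensorProduct.span_tmul_eq_top, Submodule.span_le]
  rintro _ ⟨x, y, rfl⟩
  exact h2 x y

theorem span_boundarySet_union_interiorSet (hm : 3 ≤ m) (hn : 3 ≤ n) :
    Submodule.span ℂ (boundarySet m n ∪ interiorSet m n) = ⊤ := by
  set W := Submodule.span ℂ (boundarySet m n ∪ interiorSet m n) with hW
  have left {x : Qudit m} {s : ℕ} (hs : s ≤ 1)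
      (h : ∀ v ∈ edgeVectors n s, x ⊗ₜ[ℂ] v ∈ boundarySet m n) {j : ℕ} (hj : s ≤ j)
      (hj' : j < s + (n - 1)) : x ⊗ₜ[ℂ] ket n j ∈ W :=
    (Submodule.span_le (p := W.comap (TensorProduct.mk ℂ _ _ x))).2
      (fun v hv => Submodule.subset_span (.inl (h v hv))) (ket_mem_span_edgeVectors hn hs hj hj')
  have right {y : Qudit n} {s : ℕ} (hs : s ≤ 1)
      (h : ∀ u ∈ edgeVectors m s, u ⊗ₜ[ℂ] y ∈ boundarySet m n) {i : ℕ} (hi : s ≤ i)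
      (hi' : i < s + (m - 1)) : ket m i ⊗ₜ[ℂ] y ∈ W :=
    (Submodule.span_le (p := W.comap ((TensorProduct.mk ℂ _ _).flip y))).2
      (fun u hu => Submodule.subset_span (.inl (h u hu))) (ket_mem_span_edgeVectors hm hs hi hi')
  refine eq_top_of_ket_tmul_ket_mem fun i hi j hj => ?_
  -- Each edge omits one end corner, which the next edge around the grid picks up.
  by_cases h1 : i = 0 ∧ j < n - 1
  · rw [h1.1]
    exact left zero_le_one (fun v hv => .inl (.inl (.inl ⟨v, hv, rfl⟩))) (by omega) (by omega)
  by_cases h2 : j = n - 1 ∧ i < m - 1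
  · rw [h2.1]
    exact right zero_le_one (fun u hu => .inl (.inl (.inr ⟨u, hu, rfl⟩))) (by omega) (by omega)
  by_cases h3 : i = m - 1 ∧ 1 ≤ j
  · rw [h3.1]
    exact left le_rfl (fun v hv => .inl (.inr ⟨v, hv, rfl⟩)) h3.2 (by omega)
  by_cases h4 : j = 0 ∧ 1 ≤ i
  · rw [h4.1]
    exact right le_rfl (fun u hu => .inr ⟨u, hu, rfl⟩) h4.2 (by omega)
  exact Submodule.subset_span (.inr ⟨i, j, by omega, by omega, by omega, by omega, rfl⟩)

theorem IsOrthogonalProductBasis.finite_and_ncard_eq {S : Set (Bipartite m n)}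
    (hS : IsOrthogonalProductBasis S) : S.Finite ∧ S.ncard = m * n := by
  have hli : LinearIndependent ℂ ((↑) : S → Bipartite m n) :=
    linearIndependent_of_ne_zero_of_inner_eq_zero (fun ψ => (hS.1.1 ψ ψ.2).1)
      fun ψ φ h => hS.1.2 ψ ψ.2 φ φ.2 (Subtype.coe_injective.ne h)
  refine ⟨hli.setFinite, ?_⟩
  have := Module.finrank_eq_nat_card_basis
    (Module.Basis.mk hli (by rw [Subtype.range_coe, hS.2]))
  rw [Module.finrank_tensorProduct, finrank_euclideanSpace_fin, finrank_euclideanSpace_fin] at this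
  exact this.symm

theorem ncard_interiorSet (m n : ℕ) : (interiorSet m n).ncard = (m - 2) * (n - 2) := by
  have : interiorSet m n = (fun p : ℕ × ℕ => ket m p.1 ⊗ₜ[ℂ] ket n p.2) ''
      ↑(Finset.Icc 1 (m - 2) ×ˢ Finset.Icc 1 (n - 2)) := by
    ext ψ
    constructor
    · rintro ⟨i, j, hi, hi', hj, hj', rfl⟩
      exact ⟨(i, j), by simp [*], rfl⟩
    · rintro ⟨⟨i, j⟩, h, rfl⟩
      simp only [Finset.coe_product, Finset.coe_Icc, Set.mem_prod, Set.mem_Icc] at h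
      exact ⟨i, j, h.1.1, h.1.2, h.2.1, h.2.2, rfl⟩
  rw [this, Set.InjOn.ncard_image, Set.ncard_coe_finset, Finset.card_product, Nat.card_Icc,
    Nat.card_Icc, Nat.add_sub_cancel, Nat.add_sub_cancel]
  rintro ⟨i, j⟩ h ⟨i', j'⟩ h' heq
  simp only [Finset.coe_product, Finset.coe_Icc, Set.mem_prod, Set.mem_Icc] at h h'
  -- Pairing with the first state gives 1 on one side, and 0 on the other unless the indices agree.
  have hinner := congrArg (fun φ => ⟪ket m i ⊗ₜ[ℂ] ket n j, φ⟫_ℂ) heq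
  simp only [TensorProduct.inner_tmul, inner_ket_ket (show i < m by omega),
    inner_ket_ket (show j < n by omega)] at hinner
  by_contra hne
  rw [Prod.mk.injEq, not_and_or] at hne
  rcases hne with h | h <;> simp [h] at hinner

theorem isOrthogonalProductBasis_boundarySet_union_interiorSet (hm : 3 ≤ m) (hn : 3 ≤ n) :
    IsOrthogonalProductBasis (boundarySet m n ∪ interiorSet m n) :=
  ⟨isOrthogonalProductSet_boundarySet_union_interiorSet hm hn,
    span_boundarySet_union_interiorSet hm hn⟩

theorem disjoint_boundarySet_interiorSet (hm : 3 ≤ m) (hn : 3 ≤ n) :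
    Disjoint (boundarySet m n) (interiorSet m n) := by
  rw [Set.disjoint_left]
  rintro ψ hψ ⟨i, j, hi, hi', hj, hj', rfl⟩
  have hne (φ) (h : ket m i ⊗ₜ[ℂ] ket n j = φ) : ⟪ket m i ⊗ₜ[ℂ] ket n j, φ⟫_ℂ ≠ 0 :=
    h ▸ inner_self_ne_zero.2 (isProductState_tmul (ket_ne_zero (by omega))
      (ket_ne_zero (by omega))).1
  rcases hψ with ((⟨v, -, h⟩ | ⟨u, -, h⟩) | ⟨v, -, h⟩) | ⟨u, -, h⟩ <;>
    refine hne _ h ?_ <;>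
    rw [TensorProduct.inner_tmul, inner_ket_ket (by omega), if_neg (by omega)] <;> simp

/-- Counting through the full basis avoids checking that the listed vectors are distinct: `m * n -
(m - 2) * (n - 2)` is the result. -/
theorem ncard_boundarySet (hm : 3 ≤ m) (hn : 3 ≤ n) :
    (boundarySet m n).ncard = 2 * (m + n) - 4 := by
  obtain ⟨hfin, hcard⟩ :=
    (isOrthogonalProductBasis_boundarySet_union_interiorSet hm hn).finite_and_ncard_eq
  rw [Set.ncard_union_eq (disjoint_boundarySet_interiorSet hm hn)
    (hfin.subset Set.subset_union_left) (hfin.subset Set.subset_union_right),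
    ncard_interiorSet] at hcard
  obtain ⟨a, rfl⟩ := Nat.exists_eq_add_of_le' (show 2 ≤ m by omega)
  obtain ⟨b, rfl⟩ := Nat.exists_eq_add_of_le' (show 2 ≤ n by omega)
  rw [Nat.add_sub_cancel, Nat.add_sub_cancel] at hcard
  have : (a + 2) * (b + 2) = a * b + 2 * a + 2 * b + 4 := by ring
  omega

theorem eq_smul_id_of_left_orthogonality_preserving (hm : 3 ≤ m) (hn : 3 ≤ n)
    {E : Qudit m →ₗ[ℂ] Qudit m} (hE : E.IsSymmetric)
    (h : ∀ ψ ∈ boundarySet m n, ∀ φ ∈ boundarySet m n, ψ ≠ φ →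
      ⟪ψ, TensorProduct.map E LinearMap.id φ⟫_ℂ = 0) : ∃ x : ℂ, E = x • LinearMap.id := by
  -- Non-orthogonal second factors can be cancelled, which leaves a condition on `E` alone.
  have h' {u u' : Qudit m} {v v' : Qudit n} (hψ : u ⊗ₜ[ℂ] v ∈ boundarySet m n)
      (hφ : u' ⊗ₜ[ℂ] v' ∈ boundarySet m n) (huu : u ≠ 0) (hvv : ⟪v, v'⟫_ℂ ≠ 0)
      (ho : ⟪u, u'⟫_ℂ = 0) : ⟪u, E u'⟫_ℂ = 0 := by
    have hv : v ≠ 0 := by rintro rfl; simp at hvv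
    have := h _ hψ _ hφ (ne_of_inner_eq_zero (isProductState_tmul huu hv).1 (by
      rw [TensorProduct.inner_tmul, ho, zero_mul]))
    rw [TensorProduct.map_tmul, TensorProduct.inner_tmul] at this
    exact (mul_eq_zero.1 this).resolve_right hvv
  refine exists_eq_smul_id_of_edgeVectors hm hE ?_ ?_ ?_
  · intro s hs u hu u' hu' hne
    have ho := edgeVectors_inner_eq_zero hm hs hu hu' hne
    obtain rfl | rfl : s = 0 ∨ s = 1 := by omega
    · exact h' (.inl (.inl (.inr ⟨u, hu, rfl⟩))) (.inl (.inl (.inr ⟨u', hu', rfl⟩)))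
        (edgeVectors_ne_zero hm hs hu) (inner_self_ne_zero.2 (ket_ne_zero (by omega))) ho
    · exact h' (.inr ⟨u, hu, rfl⟩) (.inr ⟨u', hu', rfl⟩)
        (edgeVectors_ne_zero hm hs hu) (inner_self_ne_zero.2 (ket_ne_zero (by omega))) ho
  · intro u hu
    -- Two edges meeting at a corner are compared: a vector `v` overlapping the corner ket makes the
    -- second factors non-orthogonal.
    obtain ⟨v, hv, hv0⟩ := exists_edgeVector_inner_ket_ne_zero (s := 0) (k := 0) hn (by omega)
      (by omega) (by omega)
    exact h' (.inl (.inl (.inl ⟨v, hv, rfl⟩))) (.inr ⟨u, hu, rfl⟩) (ket_ne_zero (by omega)) hv0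
      (inner_ket_edgeVectors hm (by omega) hu (by omega) (by omega))
  · intro u hu
    obtain ⟨v, hv, hv0⟩ := exists_edgeVector_inner_ket_ne_zero (s := 1) (k := n - 1) hn (by omega)
      (by omega) (by omega)
    exact h' (.inl (.inr ⟨v, hv, rfl⟩)) (.inl (.inl (.inr ⟨u, hu, rfl⟩))) (ket_ne_zero (by omega))
      hv0 (inner_ket_edgeVectors hm (by omega) hu (by omega) (by omega))

theorem eq_smul_id_of_right_orthogonality_preserving (hm : 3 ≤ m) (hn : 3 ≤ n)
    {E : Qudit n →ₗ[ℂ] Qudit n} (hE : E.IsSymmetric)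
    (h : ∀ ψ ∈ boundarySet m n, ∀ φ ∈ boundarySet m n, ψ ≠ φ →
      ⟪ψ, TensorProduct.map LinearMap.id E φ⟫_ℂ = 0) : ∃ x : ℂ, E = x • LinearMap.id := by
  have h' {u u' : Qudit m} {v v' : Qudit n} (hψ : u ⊗ₜ[ℂ] v ∈ boundarySet m n)
      (hφ : u' ⊗ₜ[ℂ] v' ∈ boundarySet m n) (hvv : v ≠ 0) (huu : ⟪u, u'⟫_ℂ ≠ 0)
      (ho : ⟪v, v'⟫_ℂ = 0) : ⟪v, E v'⟫_ℂ = 0 := by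
    have hu : u ≠ 0 := by rintro rfl; simp at huu
    have := h _ hψ _ hφ (ne_of_inner_eq_zero (isProductState_tmul hu hvv).1 (by
      rw [TensorProduct.inner_tmul, ho, mul_zero]))
    rw [TensorProduct.map_tmul, TensorProduct.inner_tmul] at this
    exact (mul_eq_zero.1 this).resolve_left huu
  refine exists_eq_smul_id_of_edgeVectors hn hE ?_ ?_ ?_
  · intro s hs v hv v' hv' hne
    have ho := edgeVectors_inner_eq_zero hn hs hv hv' hne
    obtain rfl | rfl : s = 0 ∨ s = 1 := by omega
    · exact h' (.inl (.inl (.inl ⟨v, hv, rfl⟩))) (.inl (.inl (.inl ⟨v', hv', rfl⟩)))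
        (edgeVectors_ne_zero hn hs hv) (inner_self_ne_zero.2 (ket_ne_zero (by omega))) ho
    · exact h' (.inl (.inr ⟨v, hv, rfl⟩)) (.inl (.inr ⟨v', hv', rfl⟩))
        (edgeVectors_ne_zero hn hs hv) (inner_self_ne_zero.2 (ket_ne_zero (by omega))) ho
  · intro v hv
    obtain ⟨u, hu, hu0⟩ := exists_edgeVector_inner_ket_ne_zero (s := 1) (k := m - 1) hm (by omega)
      (by omega) (by omega)
    exact h' (.inr ⟨u, hu, rfl⟩) (.inl (.inr ⟨v, hv, rfl⟩)) (ket_ne_zero (by omega)) hu0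
      (inner_ket_edgeVectors hn (by omega) hv (by omega) (by omega))
  · intro v hv
    obtain ⟨u, hu, hu0⟩ := exists_edgeVector_inner_ket_ne_zero (s := 0) (k := 0) hm (by omega)
      (by omega) (by omega)
    exact h' (.inl (.inl (.inr ⟨u, hu, rfl⟩))) (.inl (.inl (.inl ⟨v, hv, rfl⟩)))
      (ket_ne_zero (by omega)) hu0
      (inner_ket_edgeVectors hn (by omega) hv (by omega) (by omega))

end Boundary

theorem theorem7 (m n : ℕ) (hm : 3 ≤ m) (hn : 3 ≤ n) :
    (boundarySet m n).ncard = 2 * (m + n) - 4 ∧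
    IsOrthogonalProductSet (boundarySet m n) ∧
    ¬ LOCCDistinguishable (boundarySet m n) ∧
    IsOrthogonalProductBasis (boundarySet m n ∪ interiorSet m n) := by
  have hcard := ncard_boundarySet hm hn
  have hbasis := isOrthogonalProductBasis_boundarySet_union_interiorSet hm hn
  refine ⟨hcard, ⟨fun ψ hψ => hbasis.1.1 ψ (.inl hψ),
    fun ψ hψ φ hφ => hbasis.1.2 ψ (.inl hψ) φ (.inl hφ)⟩, ?_, hbasis⟩
  refine not_LOCCDistinguishable_of_trivial ?_ (fun ψ hψ => (hbasis.1.1 ψ (.inl hψ)).1)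
    (fun E => eq_smul_id_of_left_orthogonality_preserving hm hn)
    (fun E => eq_smul_id_of_right_orthogonality_preserving hm hn)
  have := (hbasis.finite_and_ncard_eq.1.subset Set.subset_union_left).to_subtype
  exact Set.one_lt_ncard_iff_nontrivial.1 (by omega)
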